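/- Let $K, N, M$ be natural numbers. Let $\ell_2^M$ be $\mathbb{R}^M$ with the Euclidean norm, and let $\ell_\infty^K(\ell_2^N)$ be the space of families $x=(x_1,\dots,x_K)$ of vectors $x_k\in\mathbb{R}^N$ with the norm $\max_{1\le k\le K}\|x_k\|_2$. Identify $\ell_\infty^K(\ell_2^N)\otimes\ell_2^M$ with the real block matrices $[X_1\ X_2\ \cdots\ X_K]\in\mathbb{R}^{M\times NK}$, $X_k\in\mathbb{R}^{M\times N}$, by letting $x\otimes y$ correspond to $[y x_1^*\ \cdots\ y x_K^*]$, where $^*$ denotes the transpose. For a block matrix put $\|[X_1\ \cdots\ X_K]\|_{\infty,\mathrm F}=\max_{1\le k\le K}\|X_k\|_{\mathrm F}$, where $\|\cdot\|_{\mathrm F}$ is the Frobenius norm. For $T\in\ell_\infty^K(\ell_2^N)\otimes\ell_2^M$ define \[ \|T\|_{\$}=\inf\bigl\{\|U\|_{\mathrm F}\,\|V^*\|_{\infty,\mathrm F} \,:\, d\in\mathbb{N},\ U\in\mathbb{R}^{M\times d},\ V\in\mathbb{R}^{NK\times d},\ UV^*=T\bigr\} \] and the projective norm \[ \|T\|_{\wedge}=\inf\Bigl\{\sum_{i=1}^n\|x_i\|_{\ell_\infty^K(\ell_2^N)}\,\|y_i\|_{\ell_2^M}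 \,:\, n\in\mathbb{N},\ T=\sum_{i=1}^n x_i\otimes y_i\Bigr\}. \] Then every $T\in\ell_\infty^K(\ell_2^N)\otimes\ell_2^M$ satisfies \[ \|T\|_{\$}\le\|T\|_{\wedge}\le\sqrt{2N}\,\|T\|_{\$}. \] -/

import Mathlib

open scoped TensorProduct

noncomputable section

/-- The real Banach space `ℓ_∞^K(ℓ_2^N)`: families of `K` vectors of the Euclidean space `ℝ^N`, with
the norm `max_k ‖x_k‖₂` (Mathlib's norm on a finite product is the sup norm). -/
abbrev LInftyL2 (K N : ℕ) : Type := Fin K → EuclideanSpace ℝ (Fin N)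

/-- The projective norm on the algebraic tensor product of two normed spaces: the infimum of
`∑ ‖x_i‖ ‖y_i‖` over all finite representations `T = ∑ x_i ⊗ y_i`. -/
def projNorm {E F : Type*} [NormedAddCommGroup E] [NormedSpace ℝ E]
    [NormedAddCommGroup F] [NormedSpace ℝ F] (T : E ⊗[ℝ] F) : ℝ :=
  sInf {r : ℝ | ∃ (n : ℕ) (x : Fin n → E) (y : Fin n → F),
    T = ∑ i, x i ⊗ₜ[ℝ] y i ∧ r = ∑ i, ‖x i‖ * ‖y i‖}

section Frobenius

open scoped Matrix.Norms.Frobenius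

/-- The Frobenius norm of a real matrix. -/
def frobNorm {m n : Type*} [Fintype m] [Fintype n] (A : Matrix m n ℝ) : ℝ := ‖A‖

theorem frobNorm_eq {m n : Type*} [Fintype m] [Fintype n] (A : Matrix m n ℝ) :
    frobNorm A = Real.sqrt (∑ i, ∑ j, A i j ^ 2) := by
  simp [frobNorm, Matrix.frobenius_norm_def, Real.sqrt_eq_rpow]

end Frobenius

/-- The `k`-th block `X_k` (of `N` columns) of the block matrix `X = [X_1 X_2 ⋯ X_K]`; the columns
of `X` are indexed by pairs (block, column within the block). -/
def colBlock {m : Type*} {K N : ℕ} (X : Matrix m (Fin K × Fin N) ℝ) (k : Fin K) :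
    Matrix m (Fin N) ℝ :=
  Matrix.of fun i j => X i (k, j)

/-- The maximum-block-Frobenius norm `max_k ‖X_k‖_F` (it is `0` if there are no blocks). -/
def maxBlockFrobNorm {m : Type*} [Fintype m] {K N : ℕ} (X : Matrix m (Fin K × Fin N) ℝ) : ℝ :=
  ⨆ k : Fin K, frobNorm (colBlock X k)

/-- The `$`-norm of a block matrix: the infimum of `‖U‖_F ‖V*‖_{∞,F}` over all factorizations
`X = U V*`, the common number `d` of columns of `U` and `V` being arbitrary. -/
def dollarNormMatrix {M K N : ℕ} (X : Matrix (Fin M) (Fin K × Fin N) ℝ) : ℝ :=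
  sInf {r : ℝ | ∃ (d : ℕ) (U : Matrix (Fin M) (Fin d) ℝ) (V : Matrix (Fin K × Fin N) (Fin d) ℝ),
    U * V.transpose = X ∧ r = frobNorm U * maxBlockFrobNorm V.transpose}

/-- The identification of `ℓ_∞^K(ℓ_2^N) ⊗ ℓ_2^M` with the `M × NK` block matrices: `x ⊗ y` is sent
to `y x*`, whose `k`-th block is `y x_k*`. -/
def tensorToMatrix (K N M : ℕ) :
    LInftyL2 K N ⊗[ℝ] EuclideanSpace ℝ (Fin M) →ₗ[ℝ] Matrix (Fin M) (Fin K × Fin N) ℝ :=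
  TensorProduct.lift (LinearMap.mk₂ ℝ
    (fun (x : LInftyL2 K N) (y : EuclideanSpace ℝ (Fin M)) =>
      (Matrix.of fun i p => y i * x p.1 p.2 : Matrix (Fin M) (Fin K × Fin N) ℝ))
    (by intro x x' y; ext i p; simp [mul_add])
    (by intro c x y; ext i p; simp; ring)
    (by intro x y y'; ext i p; simp [add_mul])
    (by intro c x y; ext i p; simp; ring))

/-- The `$`-norm on `ℓ_∞^K(ℓ_2^N) ⊗ ℓ_2^M`. -/
def dollarNorm {K N M : ℕ} (T : LInftyL2 K N ⊗[ℝ] EuclideanSpace ℝ (Fin M)) : ℝ :=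
  dollarNormMatrix (tensorToMatrix K N M T)

end

open MeasureTheory ProbabilityTheory
open scoped RealInnerProductSpace

/-! Lower bound: scaling the two factors of each `x_l ⊗ y_l` to balance their norms turns a
representation of cost `σ` into a factorization with both factors of norm at most `√σ`. Upper bound:
let `T = U V*`, let `v_p` be the rows of `V` and `g` a standard Gaussian vector. By
`norm_smul_integral_sign_inner_smul`, column `p` of `T` is `√(π/2) ‖v_p‖ E[sign⟪v_p, g⟫ U g]`.
Splitting the expectation over the finitely many sign patterns `s` gives `T = √(π/2) ∑ x_s ⊗ y_s`,
with `x_s = (‖v_p‖ s_p)_p` and `y_s` the integral of `U g` over the cell of `s`. Each `‖x_s‖` is at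
most `‖V*‖_{∞,F}`, and `∑ ‖y_s‖ ≤ E‖U g‖ ≤ ‖U‖_F`. The resulting constant `√(π/2)` is below `√(2N)`
once `N ≥ 1`. -/

theorem integral_abs_gaussianReal_zero_one :
    ∫ t, |t| ∂(gaussianReal 0 1) = Real.sqrt (2 / Real.pi) := by
  have h := integral_rpow_mul_exp_neg_mul_rpow (p := 2) (q := 1) (b := 1 / 2)
    (by norm_num) (by norm_num) (by norm_num)
  have e : ((1 : ℝ) + 1) / 2 = 1 := by norm_num
  have e' : (-((1 : ℝ) + 1)) / 2 = -1 := by norm_num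
  rw [e, e', Real.Gamma_one, Real.rpow_neg_one] at h
  rw [integral_gaussianReal_eq_integral_smul one_ne_zero]
  have h2 : ∀ t : ℝ, gaussianPDFReal 0 1 t • |t| =
      (fun x : ℝ => (Real.sqrt (2 * Real.pi))⁻¹ * (x * Real.exp (-(1 / 2) * x ^ (2 : ℝ)))) |t| := by
    intro t
    simp only [gaussianPDFReal, smul_eq_mul, Real.rpow_two, sq_abs, NNReal.coe_one, mul_one,
      sub_zero]
    rw [show -t ^ 2 / 2 = -(1 / 2) * t ^ 2 by ring]
    ring
  simp_rw [h2]
  rw [integral_comp_abs (f := fun x : ℝ =>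
    (Real.sqrt (2 * Real.pi))⁻¹ * (x * Real.exp (-(1 / 2) * x ^ (2 : ℝ)))), integral_const_mul]
  simp only [Real.rpow_one] at h
  rw [h, Real.sqrt_div (by norm_num), Real.sqrt_mul (by norm_num)]
  have : Real.sqrt Real.pi ≠ 0 := by positivity
  have h22 : Real.sqrt 2 * Real.sqrt 2 = 2 := Real.mul_self_sqrt (by norm_num)
  have : Real.sqrt 2 ≠ 0 := by positivity
  field_simp
  nlinarith

/-! ### Gaussian averages and Grothendieck's identity -/

section StdGaussian

variable {E : Type*} [NormedAddCommGroup E] [InnerProductSpace ℝ E] [FiniteDimensional ℝ E]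
  [MeasurableSpace E] [BorelSpace E]

theorem stdGaussian_map_inner (v : E) :
    (stdGaussian E).map (fun g => ⟪v, g⟫) = (gaussianReal 0 1).map (fun t => ‖v‖ * t) := by
  have h := IsGaussian.map_eq_gaussianReal (μ := stdGaussian E) (innerSL ℝ v)
  rw [variance_dual_stdGaussian, integral_strongDual_stdGaussian, innerSL_apply_norm] at h
  rw [gaussianReal_map_const_mul]
  convert h using 2
  · ext g; simp
  · exact mul_zero _
  · rw [mul_one, Real.toNNReal_of_nonneg (by positivity)]

theorem integral_abs_inner_stdGaussian (v : E) :
    ∫ g, |⟪v, g⟫| ∂(stdGaussian E) = Real.sqrt (2 / Real.pi) * ‖v‖ := by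
  have h : ∫ g, |⟪v, g⟫| ∂(stdGaussian E) =
      ∫ t, |t| ∂((stdGaussian E).map (fun g => ⟪v, g⟫)) :=
    (integral_map (by fun_prop) (by fun_prop)).symm
  rw [h, stdGaussian_map_inner, integral_map (by fun_prop) (by fun_prop)]
  simp_rw [abs_mul, abs_norm]
  rw [integral_const_mul, integral_abs_gaussianReal_zero_one, mul_comm]

theorem integral_inner_sq_stdGaussian (v : E) :
    ∫ g, ⟪v, g⟫ ^ 2 ∂(stdGaussian E) = ‖v‖ ^ 2 := by
  have h := variance_dual_stdGaussian (innerSL ℝ v)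
  rw [innerSL_apply_norm, variance_of_integral_eq_zero (by fun_prop)
    (integral_strongDual_stdGaussian _)] at h
  simpa using h

theorem measurable_sign_inner (v : E) :
    Measurable fun g : E => ((SignType.sign ⟪v, g⟫ : SignType) : ℝ) := by
  have h : (fun g : E => ((SignType.sign ⟪v, g⟫ : SignType) : ℝ)) =
      fun g => if 0 < ⟪v, g⟫ then 1 else if ⟪v, g⟫ < 0 then -1 else 0 := by
    ext g
    rw [sign_apply]
    split_ifs <;> simp
  rw [h]
  exact Measurable.ite (measurableSet_lt (by fun_prop) (by fun_prop)) (by fun_prop)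
    (Measurable.ite (measurableSet_lt (by fun_prop) (by fun_prop)) (by fun_prop) (by fun_prop))

theorem integrable_sign_inner_smul (v : E) :
    Integrable (fun g : E => ((SignType.sign ⟪v, g⟫ : SignType) : ℝ) • g) (stdGaussian E) := by
  refine (IsGaussian.integrable_id (μ := stdGaussian E)).bdd_smul (1 : ℝ)
    (measurable_sign_inner v).aestronglyMeasurable (ae_of_all _ fun g => ?_)
  rcases SignType.sign ⟪v, g⟫ <;> simp

/-- Grothendieck's identity in its vector form. -/
theorem norm_smul_integral_sign_inner_smul (v : E) :
    ‖v‖ • ∫ g, ((SignType.sign ⟪v, g⟫ : SignType) : ℝ) • g ∂(stdGaussian E) =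
      Real.sqrt (2 / Real.pi) • v := by
  set b := ∫ g, ((SignType.sign ⟪v, g⟫ : SignType) : ℝ) • g ∂(stdGaussian E) with hb
  -- Reflection in the line `ℝ v` fixes `v` and preserves the Gaussian measure, so it fixes `b`;
  -- hence `b` is a multiple of `v`, and pairing with `v` finds the multiple.
  let R : E ≃ₗᵢ[ℝ] E := (ℝ ∙ v).reflection
  have hRv : R v = v :=
    Submodule.reflection_mem_subspace_eq_self (Submodule.mem_span_singleton_self v)
  have hR : R b = b := by
    calc R b = ∫ g, R (((SignType.sign ⟪v, g⟫ : SignType) : ℝ) • g) ∂(stdGaussian E) :=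
          (R.toContinuousLinearEquiv.toContinuousLinearMap.integral_comp_comm
            (integrable_sign_inner_smul v)).symm
      _ = ∫ g, ((SignType.sign ⟪v, R g⟫ : SignType) : ℝ) • R g ∂(stdGaussian E) := by
          congr 1
          ext g
          rw [map_smul, ← R.inner_map_map v g, hRv]
      _ = ∫ g, ((SignType.sign ⟪v, g⟫ : SignType) : ℝ) • g ∂((stdGaussian E).map R) :=
          (integral_map (by fun_prop)
            ((measurable_sign_inner v).smul measurable_id).aestronglyMeasurable).symm
      _ = b := by rw [stdGaussian_map]
  obtain ⟨c, hc⟩ := Submodule.mem_span_singleton.1 (Submodule.reflection_eq_self_iff b |>.1 hR)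
  have hvb : ⟪v, b⟫ = Real.sqrt (2 / Real.pi) * ‖v‖ := by
    rw [← integral_abs_inner_stdGaussian, hb, ← integral_inner (integrable_sign_inner_smul v)]
    congr 1
    ext g
    rw [real_inner_smul_right, sign_mul_self]
  rw [← hc, real_inner_smul_right, real_inner_self_eq_norm_sq] at hvb
  rw [← hc, smul_smul]
  rcases eq_or_ne v 0 with rfl | hv
  · simp
  · have : ‖v‖ ≠ 0 := norm_ne_zero_iff.2 hv
    congr 1
    apply mul_right_cancel₀ this
    linarith

end StdGaussian

/-- The second moment of `‖U g‖` is the sum of the squared norms of the rows of `U`; nonnegativity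
of the variance passes to the first moment. -/
theorem integral_norm_apply_stdGaussian_le {d M : ℕ} (U : Matrix (Fin M) (Fin d) ℝ) :
    ∫ g, ‖(Matrix.toEuclideanLin U).toContinuousLinearMap g‖
      ∂(stdGaussian (EuclideanSpace ℝ (Fin d))) ≤ frobNorm U := by
  set A := (Matrix.toEuclideanLin U).toContinuousLinearMap with hA
  have hm : MemLp (fun g => ‖A g‖) 2 (stdGaussian (EuclideanSpace ℝ (Fin d))) :=
    (A.comp_memLp' IsGaussian.memLp_two_id).norm
  have hrow : ∀ g i, (A g) i = ⟪WithLp.toLp 2 (U i), g⟫ := by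
    intro g i
    simp [hA, Matrix.toLpLin_apply, Matrix.mulVec, dotProduct, PiLp.inner_apply, mul_comm]
  have hsq : ∫ g, ‖A g‖ ^ 2 ∂(stdGaussian (EuclideanSpace ℝ (Fin d))) =
      ∑ i, ∑ j, U i j ^ 2 := by
    simp_rw [EuclideanSpace.real_norm_sq_eq, hrow]
    rw [integral_finsetSum]
    · simp_rw [integral_inner_sq_stdGaussian, EuclideanSpace.real_norm_sq_eq]
    · intro i _
      exact (((innerSL ℝ (WithLp.toLp 2 (U i))).comp_memLp' IsGaussian.memLp_two_id).integrable_sq)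
  rw [frobNorm_eq, ← hsq]
  apply Real.le_sqrt_of_sq_le
  have h := variance_nonneg (fun g => ‖A g‖) (stdGaussian (EuclideanSpace ℝ (Fin d)))
  rw [variance_eq_sub hm] at h
  simpa using h

theorem measurableSet_forall_sign_inner_eq {E ι : Type*} [NormedAddCommGroup E]
    [InnerProductSpace ℝ E] [FiniteDimensional ℝ E] [MeasurableSpace E] [BorelSpace E]
    [Countable ι] (v : ι → E) (s : ι → SignType) :
    MeasurableSet {g | ∀ p, SignType.sign ⟪v p, g⟫ = s p} := by
  have hinj : ∀ a b : SignType, a = b ↔ (a : ℝ) = (b : ℝ) := by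
    intro a b
    refine ⟨fun h => h ▸ rfl, fun h => ?_⟩
    rcases a <;> rcases b <;> first | rfl | norm_num at h
  simp_rw [hinj, Set.ofPred_forall]
  exact MeasurableSet.iInter fun p =>
    measurableSet_eq_fun (measurable_sign_inner _) measurable_const

/-! ### Bounds for the projective norm -/

section ProjNorm

variable {E F : Type*} [NormedAddCommGroup E] [NormedSpace ℝ E]
  [NormedAddCommGroup F] [NormedSpace ℝ F]

theorem projNorm_le_sum {ι : Type*} [Fintype ι] (x : ι → E) (y : ι → F) :
    projNorm (∑ i, x i ⊗ₜ[ℝ] y i) ≤ ∑ i, ‖x i‖ * ‖y i‖ := by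
  apply csInf_le
  · refine ⟨0, ?_⟩
    rintro r ⟨n, x, y, -, rfl⟩
    positivity
  · let e := (Fintype.equivFin ι).symm
    exact ⟨Fintype.card ι, x ∘ e, y ∘ e, (e.sum_comp fun i => x i ⊗ₜ[ℝ] y i).symm,
      (e.sum_comp fun i => ‖x i‖ * ‖y i‖).symm⟩

theorem le_projNorm {T : E ⊗[ℝ] F} {c : ℝ}
    (h : ∀ (n : ℕ) (x : Fin n → E) (y : Fin n → F), T = ∑ i, x i ⊗ₜ[ℝ] y i →
      c ≤ ∑ i, ‖x i‖ * ‖y i‖) : c ≤ projNorm T := by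
  apply le_csInf
  · obtain ⟨S, rfl⟩ := TensorProduct.exists_finset T
    let e := S.equivFin.symm
    refine ⟨_, S.card, fun i => (e i).1.1, fun i => (e i).1.2, ?_, rfl⟩
    rw [e.sum_comp fun i : S => i.1.1 ⊗ₜ[ℝ] i.1.2, Finset.sum_coe_sort S fun i => i.1 ⊗ₜ[ℝ] i.2]
  · rintro r ⟨n, x, y, hT, rfl⟩
    exact h n x y hT

end ProjNorm

/-! ### Block matrices and the two inequalities -/

section Matrices

variable {K N M : ℕ}

@[simp]
theorem tensorToMatrix_tmul (x : LInftyL2 K N) (y : EuclideanSpace ℝ (Fin M)) (i : Fin M)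
    (p : Fin K × Fin N) : tensorToMatrix K N M (x ⊗ₜ y) i p = y i * x p.1 p.2 := rfl

/-- A tensor is recovered from its matrix as `∑ row_i ⊗ e_i`. This reduces tensor identities to
entrywise ones. -/
theorem tensorToMatrix_injective : Function.Injective (tensorToMatrix K N M) := by
  have h : ∀ T, ∑ i, (fun k => WithLp.toLp 2 fun j => tensorToMatrix K N M T i (k, j)) ⊗ₜ[ℝ]
      EuclideanSpace.single i (1 : ℝ) = T := by
    intro T
    induction T using TensorProduct.induction_on with
    | zero =>
      refine Finset.sum_eq_zero fun i _ => ?_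
      rw [map_zero]
      exact TensorProduct.zero_tmul _ _
    | tmul x y =>
      have hx : ∀ i, (fun k => WithLp.toLp 2 fun j =>
          tensorToMatrix K N M (x ⊗ₜ y) i (k, j)) = y i • x := by
        intro i; ext k j; simp
      simp_rw [hx, TensorProduct.smul_tmul]
      rw [← TensorProduct.tmul_sum]
      congr 1
      ext i
      simp [Pi.single_apply]
    | add S T hS hT =>
      conv_rhs => rw [← hS, ← hT]
      rw [← Finset.sum_add_distrib]
      refine Finset.sum_congr rfl fun i _ => ?_
      rw [← TensorProduct.add_tmul, map_add]
      rfl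
  intro S T hST
  rw [← h S, ← h T, hST]

theorem maxBlockFrobNorm_nonneg {m : Type*} [Fintype m] (X : Matrix m (Fin K × Fin N) ℝ) :
    0 ≤ maxBlockFrobNorm X :=
  Real.iSup_nonneg fun k => by rw [frobNorm_eq]; positivity

theorem frobNorm_colBlock_le {m : Type*} [Fintype m] (X : Matrix m (Fin K × Fin N) ℝ)
    (k : Fin K) : frobNorm (colBlock X k) ≤ maxBlockFrobNorm X :=
  le_ciSup (f := fun k => frobNorm (colBlock X k)) (Set.finite_range _).bddAbove k

theorem dollarNorm_le (T : LInftyL2 K N ⊗[ℝ] EuclideanSpace ℝ (Fin M)) {d : ℕ}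
    (U : Matrix (Fin M) (Fin d) ℝ) (V : Matrix (Fin K × Fin N) (Fin d) ℝ)
    (h : U * V.transpose = tensorToMatrix K N M T) :
    dollarNorm T ≤ frobNorm U * maxBlockFrobNorm V.transpose := by
  apply csInf_le
  · refine ⟨0, ?_⟩
    rintro r ⟨d, U, V, -, rfl⟩
    exact mul_nonneg (by rw [frobNorm_eq]; positivity) (maxBlockFrobNorm_nonneg _)
  · exact ⟨d, U, V, h, rfl⟩

theorem le_dollarNorm {T : LInftyL2 K N ⊗[ℝ] EuclideanSpace ℝ (Fin M)} {c : ℝ}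
    (h : ∀ (d : ℕ) (U : Matrix (Fin M) (Fin d) ℝ) (V : Matrix (Fin K × Fin N) (Fin d) ℝ),
      U * V.transpose = tensorToMatrix K N M T →
        c ≤ frobNorm U * maxBlockFrobNorm V.transpose) : c ≤ dollarNorm T := by
  apply le_csInf
  · exact ⟨_, M, 1, (tensorToMatrix K N M T).transpose, by simp, rfl⟩
  · rintro r ⟨d, U, V, hT, rfl⟩
    exact h d U V hT

theorem dollarNorm_le_projNorm (T : LInftyL2 K N ⊗[ℝ] EuclideanSpace ℝ (Fin M)) :
    dollarNorm T ≤ projNorm T := by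
  refine le_projNorm fun n x y hT => ?_
  set σ := ∑ i, ‖x i‖ * ‖y i‖ with hσ
  have hσ0 : 0 ≤ σ := by positivity
  -- With these weights column `l` of `U` has squared norm `‖x l‖ * ‖y l‖`, and each block of column
  -- `l` of `V` at most that. If a norm is zero, both weights are `0` by `r / 0 = 0`, and the lost
  -- term was zero anyway.
  let a : Fin n → ℝ := fun l => Real.sqrt (‖x l‖ / ‖y l‖)
  let b : Fin n → ℝ := fun l => Real.sqrt (‖y l‖ / ‖x l‖)
  let U : Matrix (Fin M) (Fin n) ℝ := Matrix.of fun i l => a l * y l i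
  let V : Matrix (Fin K × Fin N) (Fin n) ℝ := Matrix.of fun p l => b l * x l p.1 p.2
  have hUV : U * V.transpose = tensorToMatrix K N M T := by
    ext i p
    rw [hT, map_sum, Matrix.sum_apply, Matrix.mul_apply]
    refine Finset.sum_congr rfl fun l _ => ?_
    simp only [U, V, Matrix.of_apply, Matrix.transpose_apply, tensorToMatrix_tmul]
    rcases eq_or_ne (x l) 0 with hx | hx
    · simp [hx]
    rcases eq_or_ne (y l) 0 with hy | hy
    · simp [hy]
    have hx' : ‖x l‖ ≠ 0 := norm_ne_zero_iff.2 hx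
    have hy' : ‖y l‖ ≠ 0 := norm_ne_zero_iff.2 hy
    have hab : a l * b l = 1 := by
      rw [← Real.sqrt_mul (by positivity), Real.sqrt_eq_one]
      field_simp
    linear_combination (y l i * x l p.1 p.2) * hab
  have hdiv : ∀ s t : ℝ, s / t * t ^ 2 = s * t := by
    intro s t
    rcases eq_or_ne t 0 with rfl | ht
    · simp
    · field_simp
  have hU : frobNorm U ≤ Real.sqrt σ := by
    rw [frobNorm_eq, Finset.sum_comm]
    apply Real.sqrt_le_sqrt
    refine Finset.sum_le_sum fun l _ => ?_
    simp only [U, Matrix.of_apply, mul_pow]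
    rw [← Finset.mul_sum, ← EuclideanSpace.real_norm_sq_eq, Real.sq_sqrt (by positivity), hdiv]
  have hV : maxBlockFrobNorm V.transpose ≤ Real.sqrt σ := by
    refine Real.iSup_le (fun k => ?_) (Real.sqrt_nonneg _)
    rw [frobNorm_eq]
    apply Real.sqrt_le_sqrt
    refine Finset.sum_le_sum fun l _ => ?_
    simp only [V, colBlock, Matrix.of_apply, Matrix.transpose_apply, mul_pow]
    rw [← Finset.mul_sum, ← EuclideanSpace.real_norm_sq_eq, Real.sq_sqrt (by positivity)]
    calc ‖y l‖ / ‖x l‖ * ‖x l k‖ ^ 2 ≤ ‖y l‖ / ‖x l‖ * ‖x l‖ ^ 2 := by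
          gcongr; exact norm_le_pi_norm (x l) k
      _ = ‖x l‖ * ‖y l‖ := by rw [hdiv, mul_comm]
  calc dollarNorm T ≤ frobNorm U * maxBlockFrobNorm V.transpose := dollarNorm_le T U V hUV
    _ ≤ Real.sqrt σ * Real.sqrt σ :=
        mul_le_mul hU hV (maxBlockFrobNorm_nonneg _) (Real.sqrt_nonneg _)
    _ = σ := Real.mul_self_sqrt hσ0

/-- The upper bound with the constant of the little Grothendieck inequality: the Gaussian vector
`U g` is decomposed according to the sign pattern of the products of `g` with the rows of `V`. -/
theorem projNorm_le_of_factorization (T : LInftyL2 K N ⊗[ℝ] EuclideanSpace ℝ (Fin M)) {d : ℕ}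
    (U : Matrix (Fin M) (Fin d) ℝ) (V : Matrix (Fin K × Fin N) (Fin d) ℝ)
    (h : U * V.transpose = tensorToMatrix K N M T) :
    projNorm T ≤ Real.sqrt (Real.pi / 2) * (frobNorm U * maxBlockFrobNorm V.transpose) := by
  let γ := stdGaussian (EuclideanSpace ℝ (Fin d))
  let A := (Matrix.toEuclideanLin U).toContinuousLinearMap
  let v : Fin K × Fin N → EuclideanSpace ℝ (Fin d) := fun p => WithLp.toLp 2 (V p)
  let pat : EuclideanSpace ℝ (Fin d) → (Fin K × Fin N → SignType) :=
    fun g p => SignType.sign ⟪v p, g⟫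
  let x : (Fin K × Fin N → SignType) → LInftyL2 K N :=
    fun s k => WithLp.toLp 2 fun j => ‖v (k, j)‖ * (s (k, j) : ℝ)
  let y : (Fin K × Fin N → SignType) → EuclideanSpace ℝ (Fin M) :=
    fun s => ∫ g, (if pat g = s then A g else 0) ∂γ
  have hAint : Integrable (fun g => A g) γ := A.integrable_comp IsGaussian.integrable_id
  have hpat : ∀ s, MeasurableSet {g | pat g = s} := by
    intro s
    simpa only [pat, funext_iff] using measurableSet_forall_sign_inner_eq v s
  have hint : ∀ s, Integrable (fun g => if pat g = s then A g else 0) γ :=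
    fun s => (hAint.indicator (hpat s)).congr
      (ae_of_all _ fun g => by simp [Set.indicator_apply])
  -- Patterns may take the value `0`, so the cells partition the whole space and no null set is
  -- discarded.
  have hsum : ∀ p, ∑ s, (s p : ℝ) • y s =
      A (∫ g, ((SignType.sign ⟪v p, g⟫ : SignType) : ℝ) • g ∂γ) := by
    intro p
    rw [← A.integral_comp_comm (integrable_sign_inner_smul _)]
    simp_rw [y, ← integral_smul]
    have hint' : ∀ s, Integrable (fun g => (s p : ℝ) • if pat g = s then A g else 0) γ :=
      fun s => (hint s).smul (s p : ℝ)
    rw [← integral_finsetSum _ fun s _ => hint' s]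
    congr 1
    ext1 g
    simp [pat]
  have hc : Real.sqrt (Real.pi / 2) * Real.sqrt (2 / Real.pi) = 1 := by
    rw [← Real.sqrt_mul (by positivity), Real.sqrt_eq_one]
    field_simp
  have hT : T = ∑ s, (Real.sqrt (Real.pi / 2) • x s) ⊗ₜ[ℝ] y s := by
    apply tensorToMatrix_injective
    ext i p
    have hAv : (A (v p)) i = ∑ l, U i l * V p l := by
      simp [A, v, Matrix.toLpLin_apply, Matrix.mulVec, dotProduct]
    have h1 := congrArg (fun z => (A z) i) (norm_smul_integral_sign_inner_smul (v p))
    simp only [map_smul, PiLp.smul_apply, smul_eq_mul] at h1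
    rw [← h, map_sum, Matrix.sum_apply, Matrix.mul_apply]
    simp only [tensorToMatrix_tmul, Matrix.transpose_apply]
    rw [← hAv, ← one_mul ((A (v p)) i), ← hc, mul_assoc, ← h1, ← hsum]
    simp only [WithLp.ofLp_sum, Finset.sum_apply, PiLp.smul_apply, Pi.smul_apply, smul_eq_mul,
      Finset.mul_sum, x]
    exact Finset.sum_congr rfl fun s _ => by ring
  have hx : ∀ s, ‖x s‖ ≤ maxBlockFrobNorm V.transpose := by
    intro s
    refine (pi_norm_le_iff_of_nonneg (maxBlockFrobNorm_nonneg _)).2 fun k => ?_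
    refine le_trans ?_ (frobNorm_colBlock_le _ k)
    rw [frobNorm_eq, Finset.sum_comm, EuclideanSpace.norm_eq]
    apply Real.sqrt_le_sqrt
    refine Finset.sum_le_sum fun j _ => ?_
    have hvj : ∑ l, (colBlock V.transpose k) l j ^ 2 = ‖v (k, j)‖ ^ 2 := by
      rw [EuclideanSpace.real_norm_sq_eq]; rfl
    have hs : ((s (k, j) : SignType) : ℝ) ^ 2 ≤ 1 := by rcases s (k, j) <;> simp
    rw [hvj, Real.norm_eq_abs, sq_abs]
    simp only [x, mul_pow]
    exact mul_le_of_le_one_right (by positivity) hs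
  have hy : ∑ s, ‖y s‖ ≤ frobNorm U := by
    calc ∑ s, ‖y s‖ ≤ ∑ s, ∫ g, ‖if pat g = s then A g else 0‖ ∂γ :=
          Finset.sum_le_sum fun s _ => norm_integral_le_integral_norm _
      _ = ∫ g, ‖A g‖ ∂γ := by
          rw [← integral_finsetSum _ fun s _ => (hint s).norm]
          simp [apply_ite norm]
      _ ≤ frobNorm U := integral_norm_apply_stdGaussian_le U
  calc projNorm T ≤ ∑ s, ‖Real.sqrt (Real.pi / 2) • x s‖ * ‖y s‖ := by
        conv_lhs => rw [hT]
        exact projNorm_le_sum _ _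
    _ ≤ ∑ s, Real.sqrt (Real.pi / 2) * maxBlockFrobNorm V.transpose * ‖y s‖ := by
        refine Finset.sum_le_sum fun s _ => ?_
        rw [norm_smul, Real.norm_of_nonneg (Real.sqrt_nonneg _)]
        gcongr
        exact hx s
    _ ≤ Real.sqrt (Real.pi / 2) * maxBlockFrobNorm V.transpose * frobNorm U := by
        rw [← Finset.mul_sum]
        exact mul_le_mul_of_nonneg_left hy
          (mul_nonneg (Real.sqrt_nonneg _) (maxBlockFrobNorm_nonneg _))
    _ = _ := by ring

end Matrices

theorem lemma3 (K N M : ℕ) (T : LInftyL2 K N ⊗[ℝ] EuclideanSpace ℝ (Fin M)) :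
    dollarNorm T ≤ projNorm T ∧ projNorm T ≤ Real.sqrt (2 * (N : ℝ)) * dollarNorm T := by
  refine ⟨dollarNorm_le_projNorm T, ?_⟩
  -- For `N = 0` the constant vanishes, but so does `T`, whose matrix has no columns.
  rcases Nat.eq_zero_or_pos N with rfl | hN
  · have hT : T = ∑ i : Fin 0, (0 : LInftyL2 K 0) ⊗ₜ[ℝ] (0 : EuclideanSpace ℝ (Fin M)) := by
      apply tensorToMatrix_injective
      ext i p
      exact p.2.elim0
    rw [hT]
    refine (projNorm_le_sum _ _).trans ?_
    simp
  · have hpos : 0 < Real.sqrt (2 * (N : ℝ)) := by positivity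
    rw [← div_le_iff₀' hpos]
    refine le_dollarNorm fun d U V h => ?_
    rw [div_le_iff₀' hpos]
    refine (projNorm_le_of_factorization T U V h).trans ?_
    refine mul_le_mul_of_nonneg_right (Real.sqrt_le_sqrt ?_)
      (mul_nonneg (by rw [frobNorm_eq]; positivity) (maxBlockFrobNorm_nonneg _))
    have : (1 : ℝ) ≤ N := by exact_mod_cast hN
    -- `π / 2 ≤ 2 ≤ 2 * N`.
    linarith [Real.pi_le_four]
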